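/- Let $n$ be an even natural number, let $E=\{e_1,\dots,e_n\}$ be the canonical basis of $\mathbb{Z}_2^n$, and let $A$ be the set of register subspaces of $\mathbb{Z}_2^n$ of dimension $n/2$, i.e. the spans of the subsets of $E$ of cardinality $n/2$. For $a\in A$ and $t\in\mathbb{Z}_2^{n/2}$ write $t_a=\sum_j t_j e_{i_j}$, where $a^\perp=\mathrm{span}\{e_{i_1},\dots,e_{i_{n/2}}\}$ with $i_1<\dots<i_{n/2}$, and for $t,t'\in\mathbb{Z}_2^{n/2}$ let $$|a_{t,t'}\rangle=\frac{1}{\sqrt{|a|}}\sum_{u\in a}(-1)^{u\cdot t'_{a^\perp}}\,|u+t_a\rangle$$ be the corresponding subspace coset state in $\mathcal{H}_V=(\mathbb{C}^2)^{\otimes n}$, $V=\mathbb{Z}_2^n$. In the robust leaky monogamy-of-entanglement game with acceptance sets $U,U'\subseteq\mathbb{Z}_2^{n/2}$, Alice samples $a\in A$ and $t,t'\in\mathbb{Z}_2^{n/2}$ uniformly and sends $|a_{t,t'}\rangle$ to Bob and Charlie, who split it by a channel between them and are then isolated; both learn $a$; Bob answers with a string, which is given to Charlie; then Charlie answers with a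 string. They win if Bob's answer is in $t+U$ and Charlie's is in $t'+U'$. Formally, a strategy $\mathtt{S}$ consists of finite registers $B,C$, POVMs $\{B^a_s\}_{s\in\mathbb{Z}_2^{n/2}}$ on $B$ for $a\in A$ and $\{C^{a,s}_{s'}\}_{s'\in\mathbb{Z}_2^{n/2}}$ on $C$ for $a\in A$, $s\in\mathbb{Z}_2^{n/2}$, and a quantum channel (completely positive trace-preserving map) $\Phi$ from operators on $\mathcal{H}_V$ to operators on $\mathcal{H}_B\otimes\mathcal{H}_C$. Its winning probability is $$\mathfrak{w}_{n,A,U,U'}(\mathtt{S})=\mathop{\mathbb{E}}_{a\in A}\ \mathop{\mathbb{E}}_{t,t'\in\mathbb{Z}_2^{n/2}}\ \sum_{u\in U,\,u'\in U'}\mathrm{Tr}\Big[\big(B^a_{t+u}\otimes C^{a,t+u}_{t'+u'}\big)\,\Phi\big(|a_{t,t'}\rangle\langle a_{t,t'}|\big)\Big],$$ with expectations over the uniform distributions, and the optimal winning probability is $\mathfrak{w}^*(n,A,U,U')=\sup_{\mathtt{S}}\mathfrak{w}_{n,A,U,U'}(\mathtt{S})$. Let $B(k,r)=\{x\in\mathbb{Z}_2^k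 : |x|\le r\}$ be the Hamming ball of radius $r$ around $0$, and $h(x)=-x\log_2x-(1-x)\log_2(1-x)$ (with $0\log_2 0=0$) the binary entropy function. Then, for all real $m,m'$ with $0\le m\le n/4$ and $0\le m'\le n/4$, $$\mathfrak{w}^*\big(n,A,B(n/2,m),B(n/2,m')\big)\le\sqrt{e}\;2^{\frac n2 h\left(\frac{2m}{n}\right)+\frac n4 h\left(\frac{2m'}{n}\right)}\left(\cos\tfrac{\pi}{8}\right)^n .$$ (For $n=0$ the exponent of $2$ is read as $0$.) -/

import Mathlib

open Matrix
open scoped BigOperators Kronecker ComplexOrder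

noncomputable section

namespace RobustLeakyMoE

/-! ### Bit strings, register subspaces and coset states -/

/-- Bit strings of length `n`, i.e. the vector space `ℤ₂ⁿ`. -/
abbrev BitString (n : ℕ) : Type := Fin n → ZMod 2

/-- The canonical basis vector `e i` of `ℤ₂ⁿ`. -/
def stdVec {n : ℕ} (i : Fin n) : BitString n := Pi.single i 1

/-- The orthogonal subspace `a^⊥ = {v | u ⬝ v = 0 for all u ∈ a}`. -/
def perp {n : ℕ} (a : Submodule (ZMod 2) (BitString n)) : Submodule (ZMod 2) (BitString n) where
  carrier := {v | ∀ u ∈ a, u ⬝ᵥ v = 0}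
  add_mem' {v w} hv hw u hu := by rw [dotProduct_add, hv u hu, hw u hu, add_zero]
  zero_mem' u _ := dotProduct_zero u
  smul_mem' c v hv u hu := by rw [dotProduct_smul, hv u hu, smul_zero]

/-- A register subspace is the span of a set of canonical basis vectors. -/
def IsRegisterSubspace {n : ℕ} (a : Submodule (ZMod 2) (BitString n)) : Prop :=
  ∃ S : Finset (Fin n), a = Submodule.span (ZMod 2) (stdVec '' (S : Set (Fin n)))

/-- The indices of the canonical basis vectors that lie in `a`. -/
def basisIndices {n : ℕ} (a : Submodule (ZMod 2) (BitString n)) : Finset (Fin n) :=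
  open Classical in {i | stdVec i ∈ a}

/-- The set `A` of register subspaces of `ℤ₂ⁿ` of dimension `n / 2`
(the dimension condition is exact: there are none if `n` is odd). -/
def RegSubspace (n : ℕ) : Type :=
  {a : Submodule (ZMod 2) (BitString n) // IsRegisterSubspace a ∧ 2 * Module.finrank (ZMod 2) a = n}

instance (n : ℕ) : Fintype (RegSubspace n) :=
  @Fintype.ofFinite _ (Subtype.finite (α := Submodule (ZMod 2) (BitString n)))

theorem mem_span_stdVec {n : ℕ} (S : Finset (Fin n)) (v : BitString n) :
    v ∈ Submodule.span (ZMod 2) (stdVec '' (S : Set (Fin n))) ↔ ∀ i, i ∉ S → v i = 0 := by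
  have h : (stdVec : Fin n → BitString n) = Pi.basisFun (ZMod 2) (Fin n) := by
    ext i j; simp [stdVec]
  rw [h, Module.Basis.mem_span_image]
  constructor
  · intro hs i hi
    by_contra hne
    exact hi (by simpa using hs (a := i) (by simpa using hne))
  · intro hs i hi
    by_contra hne
    have h0 := hs i (by simpa using hne)
    simp [h0] at hi

theorem finrank_span_stdVec {n : ℕ} (S : Finset (Fin n)) :
    Module.finrank (ZMod 2) (Submodule.span (ZMod 2) (stdVec '' (S : Set (Fin n)))) = S.card := by
  have h : (stdVec : Fin n → BitString n) = Pi.basisFun (ZMod 2) (Fin n) := by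
    ext i j; simp [stdVec]
  have hli : LinearIndependent (ZMod 2) (fun i : S => (stdVec (i : Fin n) : BitString n)) := by
    rw [h]
    exact (Pi.basisFun (ZMod 2) (Fin n)).linearIndependent.comp _ Subtype.val_injective
  have h2 := finrank_span_eq_card hli
  have h3 : Set.range (fun i : S => (stdVec (i : Fin n) : BitString n))
      = stdVec '' (S : Set (Fin n)) := by
    ext v; simp
  rw [h3] at h2
  simpa using h2

theorem stdVec_mem_span {n : ℕ} (S : Finset (Fin n)) (i : Fin n) :
    stdVec i ∈ Submodule.span (ZMod 2) (stdVec '' (S : Set (Fin n))) ↔ i ∈ S := by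
  rw [mem_span_stdVec]
  constructor
  · intro h
    by_contra hi
    simpa [stdVec] using h i hi
  · intro hi j hj
    have hne : j ≠ i := fun e => hj (e ▸ hi)
    simp [stdVec, hne]

theorem basisIndices_span {n : ℕ} (S : Finset (Fin n)) :
    basisIndices (Submodule.span (ZMod 2) (stdVec '' (S : Set (Fin n)))) = S := by
  ext i
  simp [basisIndices, stdVec_mem_span]

theorem perp_span {n : ℕ} (S : Finset (Fin n)) :
    perp (Submodule.span (ZMod 2) (stdVec '' (S : Set (Fin n))))
      = Submodule.span (ZMod 2) (stdVec '' ((Sᶜ : Finset (Fin n)) : Set (Fin n))) := by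
  ext v
  rw [mem_span_stdVec]
  constructor
  · intro hv i hi
    have h := hv (stdVec i) ((stdVec_mem_span S i).2 (by simpa using hi))
    simpa [stdVec] using h
  · intro hv u hu
    rw [mem_span_stdVec] at hu
    refine Finset.sum_eq_zero fun i _ => ?_
    by_cases hi : i ∈ S
    · rw [hv i (by simpa using hi), mul_zero]
    · rw [hu i hi, zero_mul]

/-- The orthogonal subspace of a half-dimensional register subspace is again one. -/
def RegSubspace.orth {n : ℕ} (a : RegSubspace n) : RegSubspace n :=
  ⟨perp a.1, by
    obtain ⟨a, ⟨S, rfl⟩, ha⟩ := a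
    rw [finrank_span_stdVec] at ha
    refine ⟨⟨Sᶜ, perp_span S⟩, ?_⟩
    rw [perp_span, finrank_span_stdVec, Finset.card_compl, Fintype.card_fin]
    omega⟩

theorem RegSubspace.card_basisIndices {n : ℕ} (a : RegSubspace n) :
    (basisIndices a.1).card = n / 2 := by
  obtain ⟨a, ⟨S, rfl⟩, ha⟩ := a
  rw [finrank_span_stdVec] at ha
  rw [basisIndices_span]
  omega

/-- The representative `t_a = ∑ⱼ tⱼ e_{iⱼ}` of the coset of `a` labelled by `t`, where
`a^⊥ = span {e_{i₁}, e_{i₂}, …}` with `i₁ < i₂ < …`. -/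
def RegSubspace.rep {n : ℕ} (a : RegSubspace n) (t : BitString (n / 2)) : BitString n :=
  ∑ j, t j • stdVec ((basisIndices a.orth.1).orderEmbOfFin a.orth.card_basisIndices j)

/-- The subspace coset state `|a_{t,t'}⟩ = |a|^{-1/2} ∑_{u ∈ a} (-1)^{u ⬝ t'} |u + t⟩`,
for vectors `t, t' ∈ ℤ₂ⁿ`, as a vector of amplitudes in the register basis. -/
def cosetState {n : ℕ} (a : Submodule (ZMod 2) (BitString n)) (t t' : BitString n) :
    BitString n → ℂ :=
  open Classical in
  ((√(Nat.card a : ℝ) : ℝ) : ℂ)⁻¹ •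
    ∑ u : BitString n with u ∈ a, (-1 : ℂ) ^ (u ⬝ᵥ t').val • Pi.single (u + t) (1 : ℂ)

/-- The density operator `|a_{t,t'}⟩⟨a_{t,t'}|` for labels `t, t' ∈ ℤ₂^{n/2}`, where `t` labels
the coset `t_a + a` and `t'` labels the coset `t'_{a^⊥} + a^⊥`. -/
def RegSubspace.cosetDensity {n : ℕ} (a : RegSubspace n) (t t' : BitString (n / 2)) :
    Matrix (BitString n) (BitString n) ℂ :=
  let ψ := cosetState a.1 (a.rep t) (a.orth.rep t')
  vecMulVec ψ (star ψ)

/-! ### Measurements and channels -/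

/-- A positive operator-valued measurement with outcomes in `S` on the register `X`. -/
structure POVM (S X : Type) [Fintype S] [Fintype X] [DecidableEq X] where
  effect : S → Matrix X X ℂ
  posSemidef : ∀ s, (effect s).PosSemidef
  sum_eq_one : ∑ s, effect s = 1

/-- The map `id_Z ⊗ Φ`: it applies `Φ` to every `X`-block of an operator on `ZX`. -/
def idTensor (Z : Type) {X Y : Type} (Φ : Matrix X X ℂ →ₗ[ℂ] Matrix Y Y ℂ)
    (P : Matrix (Z × X) (Z × X) ℂ) : Matrix (Z × Y) (Z × Y) ℂ :=
  Matrix.of fun p q => Φ (Matrix.of fun x x' => P (p.1, x) (q.1, x')) p.2 q.2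

/-- A quantum channel: a completely positive trace-preserving map `L(X) → L(Y)`. -/
structure QuantumChannel (X Y : Type) [Fintype X] [Fintype Y] where
  toMap : Matrix X X ℂ →ₗ[ℂ] Matrix Y Y ℂ
  completely_positive : ∀ (Z : Type) [Fintype Z] (P : Matrix (Z × X) (Z × X) ℂ),
    P.PosSemidef → (idTensor Z toMap P).PosSemidef
  trace_preserving : ∀ P : Matrix X X ℂ, (toMap P).trace = P.trace

/-! ### The robust leaky monogamy-of-entanglement game -/

/-- A strategy: registers `B` and `C` for Bob and Charlie, Bob's measurements `B^a`, Charlie's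
measurements `C^{a,t}` (where `t` is the guess announced by Bob), and the splitting channel. -/
structure Strategy (n : ℕ) where
  B : Type
  C : Type
  [fintypeB : Fintype B]
  [fintypeC : Fintype C]
  [decEqB : DecidableEq B]
  [decEqC : DecidableEq C]
  bob : RegSubspace n → POVM (BitString (n / 2)) B
  charlie : RegSubspace n → BitString (n / 2) → POVM (BitString (n / 2)) C
  channel : QuantumChannel (BitString n) (B × C)

attribute [instance] Strategy.fintypeB Strategy.fintypeC Strategy.decEqB Strategy.decEqC

/-- The winning probability of `S` in the robust leaky game in which Bob's answer is accepted in
`t + U` and Charlie's answer, given after he learned Bob's answer, is accepted in `t' + U'`. -/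
def Strategy.winProb {n : ℕ} (S : Strategy n) (U U' : Finset (BitString (n / 2))) : ℝ :=
  𝔼 a : RegSubspace n, 𝔼 t : BitString (n / 2), 𝔼 t' : BitString (n / 2),
    ∑ u ∈ U, ∑ u' ∈ U',
      (((S.bob a).effect (t + u) ⊗ₖ (S.charlie a (t + u)).effect (t' + u')) *
        S.channel.toMap (a.cosetDensity t t')).trace.re

/-- The optimal winning probability, the supremum over all strategies. -/
def optimalWinProb (n : ℕ) (U U' : Finset (BitString (n / 2))) : ℝ :=
  ⨆ S : Strategy n, S.winProb U U'

/-- The Hamming ball of (real) radius `r` around `0` in `ℤ₂ᵏ`. -/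
def hammingBall (k : ℕ) (r : ℝ) : Finset (BitString k) :=
  {x | (hammingNorm x : ℝ) ≤ r}

/-- The binary entropy function, in bits. -/
def binaryEntropy (x : ℝ) : ℝ := -x * Real.logb 2 x - (1 - x) * Real.logb 2 (1 - x)

end RobustLeakyMoE

end

/-!
Every strategy wins with probability at most `|U| √|U'| cos(π/8)ⁿ` (`Strategy.winProb_le`), and
`|B(k,r)| ≤ 2 ^ (k h(r/k))` for `r ≤ k/2` (`card_hammingBall_le`). The factor `√e` is not needed.

Fix the error `u ∈ U` of Bob; this costs the factor `|U|`, and a relabelling of the answers allows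
`u = 0`. A square root of the Choi matrix of the channel yields Kraus operators, hence vectors
`ψ ∈ ℂ^V ⊗ H` with `H = ℂ^B ⊗ ℂ^C` whose squared norms sum to `2ⁿ`, and the winning
probability is `2⁻ⁿ ∑ ψ, 𝔼 a, ⟨ψ, T_a ψ⟩` for the acceptance operators
`T_a = ∑ |a_{t,t'}⟩⟨a_{t,t'}| ⊗ B^a_t C^{a,t}_{t'+u'}` (`acceptOp`). The task is to bound
`𝔼 a, T_a`.

The overlap of two acceptance operators is `T_b T_a T_b ≤ |U'| 2^{-|b \ a|} T_b`, where `|b \ a|`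
is the number of canonical basis vectors in `b` but not in `a`
(`reApplyInnerSelf_acceptOp_acceptOp_le`). To see this, drop the measurement of Charlie from `T_a`:
what remains is diagonal in the register basis of `V`, and applies `B^a_r` at the basis states in
the coset of `a` labelled `r`. As the state `|b_{t,t'}⟩` is supported on the coset of `b` labelled
`t`, no cross terms between different answers of Bob occur, although his measurements for `a` and
`b` need not commute. The cross terms between answers of Charlie are removed by Kadison's inequality
(`reApplyInnerSelf_sum_apply_le`), which also makes a dilation to projective measurements
unnecessary; convexity yields the factor `|U'|`, and the cosets of `a` and `b` intersect in at most
`|a ∩ b|` points, each of weight `1 / |b|`.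

A Schur test (`sum_reApplyInnerSelf_le_of_overlap`) turns pairwise overlaps into a bound on the sum
of a family of acceptance operators. It is applied to the following families: a uniformly random `a`
arises by pairing the `n` registers at random and then picking one register of every pair at random
(`expect_regSubspace_eq`). Along a fixed pairing the overlaps factorize, so that a row of the matrix
of overlaps averages to `√|U'| ((1 + 1/√2) / 2) ^ (n/2) = √|U'| cos(π/8)ⁿ` (`sum_pairOverlap`).
-/

open ContinuousLinearMap
open scoped InnerProductSpace MatrixOrder Matrix.Norms.L2Operator

noncomputable section

namespace RobustLeakyMoE

/-! ### Quadratic forms of positive operators -/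

section Operators

variable {H : Type*} [NormedAddCommGroup H] [InnerProductSpace ℂ H]

theorem _root_.ContinuousLinearMap.IsPositive.reApplyInnerSelf_nonneg {M : H →L[ℂ] H}
    (hM : M.IsPositive) (x : H) :
    0 ≤ M.reApplyInnerSelf x := by
  simpa [reApplyInnerSelf] using hM.re_inner_nonneg_left x

theorem reApplyInnerSelf_sum {ι : Type*} (s : Finset ι) (M : ι → H →L[ℂ] H) (x : H) :
    (∑ i ∈ s, M i).reApplyInnerSelf x = ∑ i ∈ s, (M i).reApplyInnerSelf x := by
  simp [reApplyInnerSelf, sum_inner]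

/-- Kadison's inequality for a measurement `C`, weighted by `M`: it is the nonnegativity of
`∑ s, ⟨w s - v, M (C s) (w s - v)⟩` for `v = ∑ s, C s (w s)`. -/
theorem reApplyInnerSelf_sum_apply_le {S : Type*} [Fintype S] (M : H →L[ℂ] H)
    (C : S → H →L[ℂ] H) (hMC : ∀ s, (M * C s).IsPositive) (hC : ∑ s, C s = 1) (w : S → H) :
    M.reApplyInnerSelf (∑ s, C s (w s)) ≤ ∑ s, (M * C s).reApplyInnerSelf (w s) := by
  set v := ∑ s, C s (w s) with hv
  have h0 : 0 ≤ ∑ s, (M * C s).reApplyInnerSelf (w s - v) :=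
    Finset.sum_nonneg fun s _ => (hMC s).reApplyInnerSelf_nonneg _
  have h1 : ∑ s, ⟪(M * C s) (w s), v⟫_ℂ = ⟪M v, v⟫_ℂ := by
    rw [← sum_inner, hv, map_sum]; rfl
  have h2 : ∑ s, ⟪(M * C s) v, w s⟫_ℂ = ⟪v, M v⟫_ℂ := by
    calc _ = ∑ s, ⟪v, (M * C s) (w s)⟫_ℂ := by
          refine Finset.sum_congr rfl fun s _ => ?_
          rw [(hMC s).inner_left_eq_inner_right]
      _ = _ := by rw [← inner_sum, hv, map_sum]; rfl
  have h3 : ∑ s, ⟪(M * C s) v, v⟫_ℂ = ⟪M v, v⟫_ℂ := by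
    rw [← sum_inner, ← _root_.sum_apply, ← Finset.mul_sum, hC, mul_one]
  have h4 : (⟪v, M v⟫_ℂ).re = (⟪M v, v⟫_ℂ).re := by
    rw [← inner_conj_symm, Complex.conj_re]
  have h5 : ∑ s, (M * C s).reApplyInnerSelf (w s - v) =
      (∑ s, (M * C s).reApplyInnerSelf (w s)) - (∑ s, ⟪(M * C s) (w s), v⟫_ℂ).re
        - (∑ s, ⟪(M * C s) v, w s⟫_ℂ).re + (∑ s, ⟪(M * C s) v, v⟫_ℂ).re := by
    simp only [reApplyInnerSelf, map_sub, inner_sub_left, inner_sub_right, Complex.re_sum,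
      ← Finset.sum_sub_distrib, ← Finset.sum_add_distrib]
    refine Finset.sum_congr rfl fun s _ => ?_
    simp only [RCLike.re_to_complex]
    ring
  rw [h5, h1, h2, h3, h4] at h0
  simp only [reApplyInnerSelf, RCLike.re_to_complex] at h0 ⊢
  linarith

/-- A measurement applied after one of its own effects accepts with no more probability than
the effect itself; this is the inequality `B t * B t ≤ B t`, weighted by `M`. -/
theorem reApplyInnerSelf_effect_apply_le {T : Type*} [Fintype T] (M : H →L[ℂ] H)
    (B : T → H →L[ℂ] H)
    (hMB : ∀ t, (M * B t).IsPositive) (hB1 : ∑ t, B t = 1) (t : T) (φ : H) :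
    M.reApplyInnerSelf (B t φ) ≤ (M * B t).reApplyInnerSelf φ := by
  classical
  have h := reApplyInnerSelf_sum_apply_le M B hMB hB1 (Pi.single t φ)
  rwa [Finset.sum_eq_single t (by intro s _ hs; simp [hs]) (by simp),
    Finset.sum_eq_single t (by intro s _ hs; simp [hs, reApplyInnerSelf]) (by simp),
    Pi.single_eq_same] at h

variable [CompleteSpace H]

/-- The form of a positive operator is the pullback of the inner product by a square root. -/
theorem _root_.ContinuousLinearMap.IsPositive.exists_inner_eq {M : H →L[ℂ] H}
    (hM : M.IsPositive) :
    ∃ K : H →L[ℂ] H, ∀ x y, ⟪M x, y⟫_ℂ = ⟪K x, K y⟫_ℂ := by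
  obtain ⟨K, rfl⟩ := CStarAlgebra.nonneg_iff_eq_star_mul_self.1 ((nonneg_iff_isPositive M).2 hM)
  exact ⟨K, fun x y => by simp [star_eq_adjoint, adjoint_inner_left]⟩

/-- The Cauchy–Schwarz inequality for the semi-inner product of a positive operator. -/
theorem _root_.ContinuousLinearMap.IsPositive.norm_inner_le {M : H →L[ℂ] H}
    (hM : M.IsPositive) (x y : H) :
    ‖⟪M x, y⟫_ℂ‖ ≤ √(M.reApplyInnerSelf x) * √(M.reApplyInnerSelf y) := by
  obtain ⟨K, hK⟩ := hM.exists_inner_eq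
  have h : ∀ z, M.reApplyInnerSelf z = ‖K z‖ ^ 2 := fun z => by
    rw [reApplyInnerSelf, hK, inner_self_eq_norm_sq_to_K]; norm_cast
  rw [hK, h, h, Real.sqrt_sq (norm_nonneg _), Real.sqrt_sq (norm_nonneg _)]
  exact norm_inner_le_norm _ _

theorem _root_.ContinuousLinearMap.IsPositive.reApplyInnerSelf_sum_le {ι : Type*} {M : H →L[ℂ] H}
    (hM : M.IsPositive) (s : Finset ι) (f : ι → H) :
    M.reApplyInnerSelf (∑ i ∈ s, f i) ≤ s.card * ∑ i ∈ s, M.reApplyInnerSelf (f i) := by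
  obtain ⟨K, hK⟩ := hM.exists_inner_eq
  have h : ∀ z, M.reApplyInnerSelf z = ‖K z‖ ^ 2 := fun z => by
    rw [reApplyInnerSelf, hK, inner_self_eq_norm_sq_to_K]; norm_cast
  simp only [h, map_sum]
  calc ‖∑ i ∈ s, K (f i)‖ ^ 2 ≤ (∑ i ∈ s, ‖K (f i)‖) ^ 2 := by
        gcongr; exact norm_sum_le _ _
    _ ≤ _ := sq_sum_le_card_mul_sum_sq

theorem _root_.ContinuousLinearMap.IsPositive.comp_of_commute {M N : H →L[ℂ] H}
    (hM : M.IsPositive) (hN : N.IsPositive) (h : Commute M N) : (M * N).IsPositive := by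
  rw [← nonneg_iff_isPositive] at *
  exact Commute.mul_nonneg hM hN h

/-- A Schur test: if `T j * T i * T j ≤ (c i j) ^ 2 • T j` for positive operators `T i` and the
rows of the symmetric matrix `c` sum to at most `r`, then `∑ i, T i ≤ r`. -/
theorem sum_reApplyInnerSelf_le_of_overlap {ι : Type*} [Fintype ι] (T : ι → H →L[ℂ] H)
    (hT : ∀ i, (T i).IsPositive) (c : ι → ι → ℝ) (hc : ∀ i j, 0 ≤ c i j)
    (hsymm : ∀ i j, c i j = c j i) {r : ℝ} (hr : 0 ≤ r) (hrow : ∀ i, ∑ j, c i j ≤ r)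
    (h : ∀ i j x, (T i).reApplyInnerSelf (T j x) ≤ c i j ^ 2 * (T j).reApplyInnerSelf x) (x : H) :
    ∑ i, (T i).reApplyInnerSelf x ≤ r * ‖x‖ ^ 2 := by
  set p : ι → ℝ := fun i => (T i).reApplyInnerSelf x with hp
  have hp0 : ∀ i, 0 ≤ p i := fun i => (hT i).reApplyInnerSelf_nonneg x
  set v := ∑ i, T i x with hv
  have hterm : ∀ i j, (⟪T i x, T j x⟫_ℂ).re ≤ c i j * ((p i + p j) / 2) := fun i j => by
    calc (⟪T i x, T j x⟫_ℂ).re ≤ ‖⟪T i x, T j x⟫_ℂ‖ := Complex.re_le_norm _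
      _ ≤ √(p i) * √((T i).reApplyInnerSelf (T j x)) := (hT i).norm_inner_le _ _
      _ ≤ √(p i) * √(c i j ^ 2 * p j) := by gcongr; exact h i j x
      _ = c i j * (√(p i) * √(p j)) := by
          rw [Real.sqrt_mul (sq_nonneg _), Real.sqrt_sq (hc i j)]; ring
      _ ≤ c i j * ((p i + p j) / 2) := by
          refine mul_le_mul_of_nonneg_left ?_ (hc i j)
          nlinarith [sq_nonneg (√(p i) - √(p j)), Real.sq_sqrt (hp0 i), Real.sq_sqrt (hp0 j)]
  have hvv : ‖v‖ ^ 2 ≤ r * ∑ i, p i := by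
    calc ‖v‖ ^ 2 = ∑ i, ∑ j, (⟪T i x, T j x⟫_ℂ).re := by
          have h1 := inner_self_eq_norm_sq (𝕜 := ℂ) v
          rw [← h1, hv]
          simp only [sum_inner, inner_sum, RCLike.re_to_complex, Complex.re_sum]
          exact Finset.sum_comm
      _ ≤ ∑ i, ∑ j, c i j * ((p i + p j) / 2) :=
          Finset.sum_le_sum fun i _ => Finset.sum_le_sum fun j _ => hterm i j
      _ = ∑ i, ∑ j, c i j * p i := by
          have h1 : ∑ i, ∑ j, c i j * p j = ∑ i, ∑ j, c i j * p i := by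
            rw [Finset.sum_comm]
            exact Finset.sum_congr rfl fun i _ => Finset.sum_congr rfl fun j _ => by rw [hsymm]
          have h2 : ∀ i j, c i j * ((p i + p j) / 2) = (c i j * p i) / 2 + (c i j * p j) / 2 :=
            fun i j => by ring
          simp only [h2, Finset.sum_add_distrib, ← Finset.sum_div, h1]
          ring
      _ ≤ ∑ i, r * p i := by
          refine Finset.sum_le_sum fun i _ => ?_
          rw [← Finset.sum_mul]
          exact mul_le_mul_of_nonneg_right (hrow i) (hp0 i)
      _ = _ := by rw [Finset.mul_sum]
  have hS : ∑ i, p i ≤ ‖v‖ * ‖x‖ := by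
    calc ∑ i, p i = (⟪v, x⟫_ℂ).re := by
          simp [hp, hv, reApplyInnerSelf]
      _ ≤ ‖⟪v, x⟫_ℂ‖ := Complex.re_le_norm _
      _ ≤ _ := norm_inner_le_norm _ _
  have hS0 : 0 ≤ ∑ i, p i := Finset.sum_nonneg fun i _ => hp0 i
  rcases hS0.eq_or_lt with h0 | h0
  · rw [← h0]; positivity
  · refine le_of_mul_le_mul_right ?_ h0
    calc (∑ i, p i) * ∑ i, p i ≤ (‖v‖ * ‖x‖) * (‖v‖ * ‖x‖) := by gcongr
      _ = ‖v‖ ^ 2 * ‖x‖ ^ 2 := by ring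
      _ ≤ (r * ∑ i, p i) * ‖x‖ ^ 2 := by gcongr
      _ = _ := by ring

end Operators

/-! ### The acceptance operator of the game -/

section Acceptance

variable {H : Type*} [NormedAddCommGroup H] [InnerProductSpace ℂ H]
variable {V T : Type*} [Fintype V]

/-- The map `b ⊗ 1 : ℂ^V ⊗ H → H` that contracts the register `V` with the amplitudes `b`, where
`ℂ^V ⊗ H` is encoded as the space of `H`-valued functions on `V`. -/
def contract (b : V → ℂ) : PiLp 2 (fun _ : V => H) →L[ℂ] H :=
  ∑ v, b v • PiLp.proj 2 (fun _ : V => H) v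

theorem contract_apply (b : V → ℂ) (ψ : PiLp 2 (fun _ : V => H)) :
    contract b ψ = ∑ v, b v • ψ v := by
  simp [contract]

variable [CompleteSpace H]

theorem adjoint_contract_apply (b : V → ℂ) (h : H) (v : V) :
    adjoint (contract b) h v = star (b v) • h := by
  classical
  refine ext_inner_left ℂ fun g => ?_
  have h1 := adjoint_inner_right (contract b) (WithLp.toLp 2 (Pi.single v g)) h
  rw [PiLp.inner_apply, Finset.sum_eq_single v] at h1
  · rw [contract_apply, Finset.sum_eq_single v] at h1
    · simpa [inner_smul_left, inner_smul_right] using h1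
    · intro w _ hw; simp [hw]
    · simp
  · intro w _ hw; simp [hw]
  · simp

variable [Fintype T] [AddCommGroup T]

/-- The acceptance operator of the game in which the answer of Bob has to be the label `t` and the
answer of Charlie has to lie in `t' + U'`, with measurements `B` and `C` on the common space `H`
and states with amplitudes `β t t'`. -/
def acceptOp (β : T → T → V → ℂ) (B : T → H →L[ℂ] H) (C : T → T → H →L[ℂ] H) (U' : Finset T) :
    PiLp 2 (fun _ : V => H) →L[ℂ] PiLp 2 (fun _ : V => H) :=
  ∑ t, ∑ t', ∑ u' ∈ U', adjoint (contract (β t t')) ∘L (B t * C t (t' + u')) ∘L contract (β t t')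

variable {β : T → T → V → ℂ} {B : T → H →L[ℂ] H} {C : T → T → H →L[ℂ] H} {U' : Finset T}

theorem reApplyInnerSelf_acceptOp (ψ : PiLp 2 (fun _ : V => H)) :
    (acceptOp β B C U').reApplyInnerSelf ψ =
      ∑ t, ∑ t', ∑ u' ∈ U', (B t * C t (t' + u')).reApplyInnerSelf (contract (β t t') ψ) := by
  simp only [acceptOp, reApplyInnerSelf_sum]
  refine Finset.sum_congr rfl fun t _ => Finset.sum_congr rfl fun t' _ =>
    Finset.sum_congr rfl fun u' _ => ?_
  simp [reApplyInnerSelf, adjoint_inner_left]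

theorem acceptOp_apply (ψ : PiLp 2 (fun _ : V => H)) (x : V) :
    acceptOp β B C U' ψ x =
      ∑ t, ∑ t', ∑ u' ∈ U', star (β t t' x) • B t (C t (t' + u') (contract (β t t') ψ)) := by
  simp [acceptOp, adjoint_contract_apply]

theorem isPositive_acceptOp (hB : ∀ t, (B t).IsPositive) (hC : ∀ t s, (C t s).IsPositive)
    (hBC : ∀ t s, Commute (B t) (C t s)) : (acceptOp β B C U').IsPositive := by
  refine isPositive_sum _ fun t _ => isPositive_sum _ fun t' _ => isPositive_sum _ fun u' _ => ?_
  exact ((hB t).comp_of_commute (hC t _) (hBC t _)).adjoint_conj _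

/-- If the states `β t t'` with fixed `t` form an orthonormal basis of the functions supported on
`{x | lab x = t}`, then dropping the measurement of Charlie from the acceptance operator leaves
the operator that applies `B (lab x)` at the basis state `x`. -/
theorem reApplyInnerSelf_acceptOp_le [DecidableEq V] [DecidableEq T] (lab : V → T)
    (hβ : ∀ t x y, ∑ t', star (β t t' x) * β t t' y = if x = y ∧ lab x = t then 1 else 0)
    (hB : ∀ t, (B t).IsPositive) (hC : ∀ t s, (C t s).IsPositive)
    (hBC : ∀ t s, Commute (B t) (C t s)) (hC1 : ∀ t, ∑ s, C t s = 1)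
    (χ : PiLp 2 (fun _ : V => H)) :
    (acceptOp β B C U').reApplyInnerSelf χ ≤ ∑ x, (B (lab x)).reApplyInnerSelf (χ x) := by
  rw [reApplyInnerSelf_acceptOp]
  have h1 : ∀ t t', ∑ u' ∈ U', (B t * C t (t' + u')).reApplyInnerSelf (contract (β t t') χ) ≤
      (B t).reApplyInnerSelf (contract (β t t') χ) := fun t t' => by
    calc _ ≤ ∑ u', (B t * C t (t' + u')).reApplyInnerSelf (contract (β t t') χ) :=
          Finset.sum_le_sum_of_subset_of_nonneg (Finset.subset_univ _) fun u' _ _ =>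
            ((hB t).comp_of_commute (hC t _) (hBC t _)).reApplyInnerSelf_nonneg _
      _ = ∑ s, (B t * C t s).reApplyInnerSelf (contract (β t t') χ) :=
          Equiv.sum_comp (Equiv.addLeft t')
            fun s => (B t * C t s).reApplyInnerSelf (contract (β t t') χ)
      _ = _ := by rw [← reApplyInnerSelf_sum, ← Finset.mul_sum, hC1, mul_one]
  have h2 : ∀ t, ∑ t', (B t).reApplyInnerSelf (contract (β t t') χ) =
      ∑ x, if lab x = t then (B t).reApplyInnerSelf (χ x) else 0 := fun t => by
    have h3 : ∀ t', ⟪B t (contract (β t t') χ), contract (β t t') χ⟫_ℂ =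
        ∑ x, ∑ y, (star (β t t' x) * β t t' y) * ⟪B t (χ x), χ y⟫_ℂ := fun t' => by
      simp only [contract_apply, map_sum, sum_inner, inner_sum, map_smul, inner_smul_left,
        inner_smul_right, starRingEnd_apply]
      rw [Finset.sum_comm]
      simp only [Finset.mul_sum]
      exact Finset.sum_congr rfl fun x _ => Finset.sum_congr rfl fun y _ => by ring
    have h4 : ∑ t', ⟪B t (contract (β t t') χ), contract (β t t') χ⟫_ℂ =
        ∑ x, if lab x = t then ⟪B t (χ x), χ x⟫_ℂ else 0 := by
      simp only [h3]
      rw [Finset.sum_comm]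
      refine Finset.sum_congr rfl fun x _ => ?_
      rw [Finset.sum_comm]
      simp only [← Finset.sum_mul, hβ]
      rw [Finset.sum_eq_single x]
      · split_ifs <;> simp_all
      · intro y _ hy; simp [hy.symm]
      · simp
    have h5 := congrArg Complex.re h4
    simp only [Complex.re_sum] at h5
    simp only [reApplyInnerSelf, RCLike.re_to_complex]
    rw [h5]
    exact Finset.sum_congr rfl fun x _ => by split_ifs <;> simp
  calc _ ≤ ∑ t, ∑ t', (B t).reApplyInnerSelf (contract (β t t') χ) :=
        Finset.sum_le_sum fun t _ => Finset.sum_le_sum fun t' _ => h1 t t'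
    _ = ∑ x, ∑ t, if lab x = t then (B t).reApplyInnerSelf (χ x) else 0 := by
        rw [Finset.sum_congr rfl fun t _ => h2 t, Finset.sum_comm]
    _ = _ := by simp

/-- The value at a basis state `x` of the image of the acceptance operator only involves the states
`β t t'` with `t = lab x`, so a measurement `R` of it, commuting with the one of Charlie, is bounded
through Kadison's inequality for Charlie's measurement and convexity of the quadratic form. -/
theorem reApplyInnerSelf_acceptOp_apply_le (lab : V → T) {κ : ℝ}
    (hβ0 : ∀ t t' x, lab x ≠ t → β t t' x = 0) (hβ1 : ∀ t t' x, ‖β t t' x‖ ^ 2 ≤ κ)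
    (hC : ∀ t s, (C t s).IsPositive) (hBC : ∀ t s, Commute (B t) (C t s))
    (hC1 : ∀ t, ∑ s, C t s = 1) {R : H →L[ℂ] H} (hR : R.IsPositive)
    (hRC : ∀ t s, Commute R (C t s)) (ψ : PiLp 2 (fun _ : V => H)) (x : V) :
    R.reApplyInnerSelf (acceptOp β B C U' ψ x) ≤
      U'.card * κ * ∑ t', ∑ u' ∈ U', (R * C (lab x) (t' + u')).reApplyInnerSelf
        (B (lab x) (contract (β (lab x) t') ψ)) := by
  set t := lab x with ht
  have hRCp : ∀ s, (R * C t s).IsPositive := fun s => hR.comp_of_commute (hC t s) (hRC t s)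
  -- Charlie's answer `s` replaces the label `t' = s - u'` as summation variable.
  have h1 : acceptOp β B C U' ψ x = ∑ s, C t s
      (∑ u' ∈ U', star (β t (s - u') x) • B t (contract (β t (s - u')) ψ)) := by
    have h2 : ∀ t', ∑ u' ∈ U', star (β t t' x) • B t (C t (t' + u') (contract (β t t') ψ)) =
        ∑ u' ∈ U', C t (t' + u') (star (β t t' x) • B t (contract (β t t') ψ)) := fun t' => by
      refine Finset.sum_congr rfl fun u' _ => ?_
      rw [map_smul]
      exact congrArg _ (DFunLike.congr_fun (hBC t (t' + u')).eq (contract (β t t') ψ))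
    rw [acceptOp_apply, Finset.sum_eq_single t]
    · simp only [h2, map_sum]
      rw [Finset.sum_comm, Finset.sum_comm (s := Finset.univ (α := T))]
      refine Finset.sum_congr rfl fun u' _ => ?_
      refine (Equiv.sum_comp (Equiv.subRight u') fun t' =>
        C t (t' + u') (star (β t t' x) • B t (contract (β t t') ψ))).symm.trans ?_
      simp
    · intro t₁ _ ht₁
      simp [hβ0 t₁ _ x (ht ▸ ht₁.symm)]
    · simp
  have hκ : 0 ≤ κ := (sq_nonneg _).trans (hβ1 t t x)
  rw [h1]
  calc _ ≤ ∑ s, (R * C t s).reApplyInnerSelf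
        (∑ u' ∈ U', star (β t (s - u') x) • B t (contract (β t (s - u')) ψ)) :=
        reApplyInnerSelf_sum_apply_le _ _ hRCp (hC1 t) _
    _ ≤ ∑ s, U'.card * ∑ u' ∈ U', κ * (R * C t s).reApplyInnerSelf
        (B t (contract (β t (s - u')) ψ)) := by
        refine Finset.sum_le_sum fun s _ => ((hRCp s).reApplyInnerSelf_sum_le _ _).trans ?_
        gcongr with u' _
        rw [reApplyInnerSelf_smul, norm_star]
        exact mul_le_mul_of_nonneg_right (hβ1 _ _ _) ((hRCp s).reApplyInnerSelf_nonneg _)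
    _ = U'.card * κ * ∑ s, ∑ u' ∈ U', (R * C t s).reApplyInnerSelf
        (B t (contract (β t (s - u')) ψ)) := by
        simp only [← Finset.mul_sum, mul_assoc]
    _ = _ := by
        congr 1
        rw [Finset.sum_comm, Finset.sum_comm (s := Finset.univ (α := T))]
        refine Finset.sum_congr rfl fun u' _ => ?_
        refine (Equiv.sum_comp (Equiv.addRight u') fun s =>
          (R * C t s).reApplyInnerSelf (B t (contract (β t (s - u')) ψ))).symm.trans ?_
        simp

end Acceptance

section Overlap

variable {H : Type*} [NormedAddCommGroup H] [InnerProductSpace ℂ H] [CompleteSpace H]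
variable {V T ι : Type*} [Fintype V] [Fintype T] [AddCommGroup T]
variable {β : ι → T → T → V → ℂ} {lab : ι → V → T} {B : ι → T → H →L[ℂ] H}
  {C : ι → T → T → H →L[ℂ] H} {U' : Finset T}

/-- The overlap of the acceptance operators of two questions `i` and `j`. The state space is
partitioned by the labels of both questions; `K` bounds the size of a block, and `κ` is the squared
modulus of the amplitudes of the states of question `j`. -/
theorem reApplyInnerSelf_acceptOp_acceptOp_le [DecidableEq V] [DecidableEq T]
    (hβ : ∀ i t x y, ∑ t', star (β i t t' x) * β i t t' y = if x = y ∧ lab i x = t then 1 else 0)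
    (hβ0 : ∀ i t t' x, lab i x ≠ t → β i t t' x = 0) {κ : ℝ}
    (hβ1 : ∀ i t t' x, ‖β i t t' x‖ ^ 2 ≤ κ)
    (hB : ∀ i t, (B i t).IsPositive) (hB1 : ∀ i, ∑ t, B i t = 1)
    (hC : ∀ i t s, (C i t s).IsPositive) (hC1 : ∀ i t, ∑ s, C i t s = 1)
    (hBC : ∀ i j r t s, Commute (B i r) (C j t s)) (i j : ι) {K : ℕ}
    (hK : ∀ r t, (Finset.univ.filter fun x => lab i x = r ∧ lab j x = t).card ≤ K)
    (ψ : PiLp 2 (fun _ : V => H)) :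
    (acceptOp (β i) (B i) (C i) U').reApplyInnerSelf (acceptOp (β j) (B j) (C j) U' ψ) ≤
      U'.card * (κ * K) * (acceptOp (β j) (B j) (C j) U').reApplyInnerSelf ψ := by
  rcases isEmpty_or_nonempty V with hV | ⟨⟨x₀⟩⟩
  · have h0 : ψ = 0 := by ext v; exact hV.elim v
    simp [h0, reApplyInnerSelf]
  have hκ : 0 ≤ κ := (sq_nonneg _).trans (hβ1 j (lab j x₀) (lab j x₀) x₀)
  set χ := acceptOp (β j) (B j) (C j) U' ψ with hχ
  set g : T → T → ℝ := fun r t => ∑ t', ∑ u' ∈ U', (B i r * C j t (t' + u')).reApplyInnerSelf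
        (B j t (contract (β j t t') ψ)) with hg
  have hg0 : ∀ r t, 0 ≤ g r t := fun r t => Finset.sum_nonneg fun t' _ =>
    Finset.sum_nonneg fun u' _ =>
      ((hB i r).comp_of_commute (hC j t _) (hBC i j r t _)).reApplyInnerSelf_nonneg _
  have hgx : ∑ x, g (lab i x) (lab j x) ≤ K * ∑ t, ∑ r, g r t := by
    calc ∑ x, g (lab i x) (lab j x)
        = ∑ p : T × T, ∑ x with (lab i x, lab j x) = p, g p.1 p.2 := by
          rw [← Finset.sum_fiberwise _ (fun x => (lab i x, lab j x))]
          refine Finset.sum_congr rfl fun p _ => Finset.sum_congr rfl fun x hx => ?_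
          rw [← (Finset.mem_filter.1 hx).2]
      _ ≤ ∑ p : T × T, K * g p.1 p.2 := by
          refine Finset.sum_le_sum fun p _ => ?_
          rw [Finset.sum_const, nsmul_eq_mul]
          refine mul_le_mul_of_nonneg_right ?_ (hg0 _ _)
          have h := hK p.1 p.2
          simp only [Prod.ext_iff]
          exact_mod_cast h
      _ = _ := by rw [← Finset.mul_sum, Fintype.sum_prod_type, Finset.sum_comm]
  have hgr : ∀ t, ∑ r, g r t ≤
      ∑ t', ∑ u' ∈ U', (B j t * C j t (t' + u')).reApplyInnerSelf (contract (β j t t') ψ) := by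
    intro t
    rw [hg, Finset.sum_comm]
    refine Finset.sum_le_sum fun t' _ => ?_
    rw [Finset.sum_comm]
    refine Finset.sum_le_sum fun u' _ => ?_
    rw [← reApplyInnerSelf_sum, ← Finset.sum_mul, hB1, one_mul, (hBC j j t t (t' + u')).eq]
    refine reApplyInnerSelf_effect_apply_le _ (B j) (fun s => ?_) (hB1 j) t _
    exact (hC j t _).comp_of_commute (hB j s) (hBC j j s t _).symm
  calc _ ≤ ∑ x, (B i (lab i x)).reApplyInnerSelf (χ x) :=
        reApplyInnerSelf_acceptOp_le (lab i) (hβ i) (hB i) (hC i)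
          (fun t => hBC i i t t) (hC1 i) χ
    _ ≤ ∑ x, U'.card * κ * g (lab i x) (lab j x) := Finset.sum_le_sum fun x _ =>
        reApplyInnerSelf_acceptOp_apply_le (lab j) (hβ0 j) (hβ1 j) (hC j)
          (fun t => hBC j j t t) (hC1 j)
          (hB i (lab i x)) (hBC i j (lab i x)) ψ x
    _ = U'.card * κ * ∑ x, g (lab i x) (lab j x) := by rw [Finset.mul_sum]
    _ ≤ U'.card * κ * (K * ∑ t, ∑ r, g r t) := by gcongr
    _ ≤ U'.card * κ * (K * ∑ t, ∑ t', ∑ u' ∈ U',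
        (B j t * C j t (t' + u')).reApplyInnerSelf (contract (β j t t') ψ)) := by
        gcongr (U'.card : ℝ) * κ * (K * ?_)
        exact Finset.sum_le_sum fun t _ => hgr t
    _ = _ := by rw [reApplyInnerSelf_acceptOp]; ring

end Overlap

/-! ### Amplitudes of subspace coset states -/

section Coset

variable {n : ℕ}

theorem RegSubspace.mem_iff (a : RegSubspace n) (v : BitString n) :
    v ∈ a.1 ↔ ∀ i, i ∉ basisIndices a.1 → v i = 0 := by
  obtain ⟨a, ⟨S, rfl⟩, ha⟩ := a
  rw [mem_span_stdVec, basisIndices_span]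

theorem RegSubspace.basisIndices_orth (a : RegSubspace n) :
    basisIndices a.orth.1 = (basisIndices a.1)ᶜ := by
  obtain ⟨a, ⟨S, rfl⟩, ha⟩ := a
  simp only [RegSubspace.orth, perp_span, basisIndices_span]

theorem RegSubspace.natCard (a : RegSubspace n) : Nat.card a.1 = 2 ^ (n / 2) := by
  have h := a.2.2
  rw [Module.natCard_eq_pow_finrank (K := ZMod 2), Nat.card_zmod]
  congr 1
  omega

/-- The increasing enumeration of the indices of the canonical basis vectors in `a^⊥`. -/
def RegSubspace.idx (a : RegSubspace n) (j : Fin (n / 2)) : Fin n :=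
  (basisIndices a.orth.1).orderEmbOfFin a.orth.card_basisIndices j

theorem RegSubspace.idx_injective (a : RegSubspace n) : Function.Injective a.idx :=
  ((basisIndices a.orth.1).orderEmbOfFin a.orth.card_basisIndices).injective

theorem RegSubspace.exists_idx_eq (a : RegSubspace n) (i : Fin n) :
    (∃ j, a.idx j = i) ↔ i ∉ basisIndices a.1 := by
  have h := Finset.range_orderEmbOfFin (basisIndices a.orth.1) a.orth.card_basisIndices
  have h2 : i ∈ Set.range a.idx ↔ i ∈ (basisIndices a.orth.1 : Set (Fin n)) := by
    rw [← h]; rfl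
  rw [a.basisIndices_orth] at h2
  simpa using h2

theorem RegSubspace.rep_apply (a : RegSubspace n) (t : BitString (n / 2)) (i : Fin n) :
    a.rep t i = ∑ j, if i = a.idx j then t j else 0 := by
  simp only [RegSubspace.rep, Finset.sum_apply, Pi.smul_apply, stdVec, Pi.single_apply,
    smul_eq_mul, mul_ite, mul_one, mul_zero]
  rfl

theorem RegSubspace.rep_idx (a : RegSubspace n) (t : BitString (n / 2)) (j : Fin (n / 2)) :
    a.rep t (a.idx j) = t j := by
  simp [RegSubspace.rep_apply, a.idx_injective.eq_iff]

/-- The label `t` of the coset `t_a + a` that contains `x`. -/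
def RegSubspace.label (a : RegSubspace n) (x : BitString n) : BitString (n / 2) :=
  fun j => x (a.idx j)

theorem RegSubspace.sub_rep_mem_iff (a : RegSubspace n) (t : BitString (n / 2))
    (x : BitString n) : x - a.rep t ∈ a.1 ↔ a.label x = t := by
  rw [a.mem_iff]
  constructor
  · intro h
    ext j
    have h1 := h (a.idx j) ((a.exists_idx_eq _).1 ⟨j, rfl⟩)
    rw [Pi.sub_apply, a.rep_idx, sub_eq_zero] at h1
    exact h1
  · rintro rfl i hi
    obtain ⟨j, rfl⟩ := (a.exists_idx_eq i).2 hi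
    rw [Pi.sub_apply, a.rep_idx, RegSubspace.label, sub_self]

/-- The amplitudes of the coset state `|a_{t,t'}⟩`. -/
def RegSubspace.amp (a : RegSubspace n) (t t' : BitString (n / 2)) : BitString n → ℂ :=
  cosetState a.1 (a.rep t) (a.orth.rep t')

theorem RegSubspace.amp_apply (a : RegSubspace n) (t t' : BitString (n / 2)) (x : BitString n) :
    a.amp t t' x = if a.label x = t then
      ((√((2 : ℝ) ^ (n / 2)) : ℝ) : ℂ)⁻¹ * (-1) ^ ((x - a.rep t) ⬝ᵥ a.orth.rep t').val else 0 := by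
  classical
  rw [RegSubspace.amp, cosetState, a.natCard, Pi.smul_apply, Finset.sum_apply, smul_eq_mul]
  have h : ∀ u : BitString n, ((-1 : ℂ) ^ (u ⬝ᵥ a.orth.rep t').val •
      (Pi.single (u + a.rep t) (1 : ℂ) : BitString n → ℂ)) x =
      if u = x - a.rep t then (-1 : ℂ) ^ ((x - a.rep t) ⬝ᵥ a.orth.rep t').val else 0 := by
    intro u
    rw [Pi.smul_apply, Pi.single_apply, smul_eq_mul]
    by_cases hu : u = x - a.rep t
    · subst hu; simp
    · rw [if_neg hu, if_neg (fun h => hu (by rw [h, add_sub_cancel_right])), mul_zero]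
  simp only [h, Finset.sum_ite_eq', Finset.mem_filter, Finset.mem_univ, true_and,
    a.sub_rep_mem_iff]
  push_cast
  split_ifs <;> simp

theorem RegSubspace.amp_eq_zero (a : RegSubspace n) (t t' : BitString (n / 2)) (x : BitString n)
    (h : a.label x ≠ t) : a.amp t t' x = 0 := by
  rw [a.amp_apply, if_neg h]

theorem RegSubspace.norm_amp_sq_le (a : RegSubspace n) (t t' : BitString (n / 2))
    (x : BitString n) : ‖a.amp t t' x‖ ^ 2 ≤ ((2 : ℝ) ^ (n / 2))⁻¹ := by
  rw [a.amp_apply]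
  split_ifs
  · simp [Real.sq_sqrt]
  · simp

theorem neg_one_pow_val_add (u v : ZMod 2) :
    (-1 : ℂ) ^ (u + v).val = (-1) ^ u.val * (-1) ^ v.val := by
  rw [← pow_add, ZMod.val_add, ← neg_one_pow_eq_pow_mod_two]

theorem neg_one_pow_val_sum {ι : Type*} (s : Finset ι) (f : ι → ZMod 2) :
    (-1 : ℂ) ^ (∑ i ∈ s, f i).val = ∏ i ∈ s, (-1) ^ (f i).val := by
  classical
  induction s using Finset.induction_on with
  | empty => simp
  | insert i s hi ih => rw [Finset.sum_insert hi, Finset.prod_insert hi, neg_one_pow_val_add, ih]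

/-- Orthogonality of the characters of `ℤ₂ᵏ`. -/
theorem sum_neg_one_pow_dotProduct (k : ℕ) (z : BitString k) :
    ∑ t : BitString k, (-1 : ℂ) ^ (∑ j, z j * t j).val = if z = 0 then 2 ^ k else 0 := by
  have h1 : ∀ c : ZMod 2, ∑ b : ZMod 2, (-1 : ℂ) ^ (c * b).val = if c = 0 then 2 else 0 := by
    intro c
    rw [show (Finset.univ : Finset (ZMod 2)) = {0, 1} from rfl]
    obtain rfl | rfl : c = 0 ∨ c = 1 := by revert c; decide
    · simp
    · simp [ZMod.val_one]
  calc ∑ t : BitString k, (-1 : ℂ) ^ (∑ j, z j * t j).val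
      = ∑ t : BitString k, ∏ j, (-1 : ℂ) ^ (z j * t j).val := by simp only [neg_one_pow_val_sum]
    _ = ∏ j, ∑ b : ZMod 2, (-1 : ℂ) ^ (z j * b).val := by
        rw [Finset.prod_univ_sum, Fintype.piFinset_univ]
    _ = ∏ j, if z j = 0 then (2 : ℂ) else 0 := by simp only [h1]
    _ = _ := by
        split_ifs with hz
        · subst hz; simp
        · obtain ⟨j, hj⟩ := Function.ne_iff.1 hz
          exact Finset.prod_eq_zero (Finset.mem_univ j) (by simpa using hj)

theorem RegSubspace.dotProduct_rep (a : RegSubspace n) (u : BitString n)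
    (t : BitString (n / 2)) : u ⬝ᵥ a.rep t = ∑ j, u (a.idx j) * t j := by
  simp only [dotProduct, a.rep_apply, Finset.mul_sum, mul_ite, mul_zero]
  rw [Finset.sum_comm]
  simp

/-- For fixed `t`, the coset states `|a_{t,t'}⟩` resolve the projector on the span of the register
basis states in the coset `t_a + a`. -/
theorem RegSubspace.sum_star_amp_mul_amp (a : RegSubspace n) (t : BitString (n / 2))
    (x y : BitString n) :
    ∑ t', star (a.amp t t' x) * a.amp t t' y = if x = y ∧ a.label x = t then 1 else 0 := by
  by_cases hx : a.label x = t
  swap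
  · simp [a.amp_apply, hx]
  by_cases hy : a.label y = t
  swap
  · have hxy : x ≠ y := fun h => hy (h ▸ hx)
    simp [a.amp_apply, hy, hxy]
  have hpos : (0 : ℝ) < 2 ^ (n / 2) := by positivity
  have hterm : ∀ t', star (a.amp t t' x) * a.amp t t' y =
      ((2 : ℂ) ^ (n / 2))⁻¹ * (-1) ^ (∑ j, (x + y) (a.orth.idx j) * t' j).val := by
    intro t'
    rw [a.amp_apply, a.amp_apply, if_pos hx, if_pos hy]
    have hs : ((√((2 : ℝ) ^ (n / 2)) : ℝ) : ℂ)⁻¹ * ((√((2 : ℝ) ^ (n / 2)) : ℝ) : ℂ)⁻¹ =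
        ((2 : ℂ) ^ (n / 2))⁻¹ := by
      rw [← mul_inv, ← Complex.ofReal_mul, Real.mul_self_sqrt hpos.le]
      push_cast; rfl
    have hd : (x - a.rep t) ⬝ᵥ a.orth.rep t' + (y - a.rep t) ⬝ᵥ a.orth.rep t' =
        ∑ j, (x + y) (a.orth.idx j) * t' j := by
      rw [← add_dotProduct, ← a.orth.dotProduct_rep]
      congr 1
      have : a.rep t + a.rep t = 0 := funext fun i => CharTwo.add_self_eq_zero _
      calc x - a.rep t + (y - a.rep t) = x + y - (a.rep t + a.rep t) := by abel
        _ = x + y := by rw [this, sub_zero]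
    rw [← hd, neg_one_pow_val_add, ← hs]
    simp only [star_mul', star_pow, star_neg, star_one, star_inv₀, Complex.star_def,
      Complex.conj_ofReal]
    ring
  simp only [hterm, ← Finset.mul_sum]
  rw [sum_neg_one_pow_dotProduct _ (fun j => (x + y) (a.orth.idx j))]
  have hiff : (fun j => (x + y) (a.orth.idx j)) = 0 ↔ x = y := by
    constructor
    · intro h
      ext i
      by_cases hi : i ∈ basisIndices a.1
      · obtain ⟨j, rfl⟩ := (a.orth.exists_idx_eq i).2 (by simpa [a.basisIndices_orth] using hi)
        exact CharTwo.add_eq_zero.1 (congrFun h j)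
      · obtain ⟨j, rfl⟩ := (a.exists_idx_eq i).2 hi
        exact congrFun (hx.trans hy.symm) j
    · rintro rfl
      ext j
      exact CharTwo.add_self_eq_zero _
  simp only [hiff, hx, and_true]
  split_ifs
  · exact inv_mul_cancel₀ (by positivity)
  · simp

/-- A vector with prescribed labels for `a` and `b` is determined by its coordinates in the
directions common to `a` and `b`. -/
theorem RegSubspace.card_label_eq_le (a b : RegSubspace n) (r t : BitString (n / 2)) :
    (Finset.univ.filter fun x => a.label x = r ∧ b.label x = t).card ≤
      2 ^ (basisIndices a.1 ∩ basisIndices b.1).card := by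
  set S := basisIndices a.1 ∩ basisIndices b.1 with hS
  have h : (Finset.univ : Finset (S → ZMod 2)).card = 2 ^ S.card := by simp
  rw [← h]
  refine Finset.card_le_card_of_injOn (fun x i => x i.1)
    (fun _ _ => Finset.mem_coe.2 (Finset.mem_univ _)) ?_
  intro x hx y hy hxy
  simp only [Finset.coe_filter, Finset.mem_univ, true_and, Set.mem_ofPred_eq] at hx hy
  ext i
  by_cases hi : i ∈ S
  · exact congrFun hxy ⟨i, hi⟩
  · rw [hS, Finset.mem_inter, not_and_or] at hi
    rcases hi with hi | hi
    · obtain ⟨j, rfl⟩ := (a.exists_idx_eq i).2 hi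
      exact congrFun (hx.1.trans hy.1.symm) j
    · obtain ⟨j, rfl⟩ := (b.exists_idx_eq i).2 hi
      exact congrFun (hx.2.trans hy.2.symm) j

end Coset

/-! ### Averaging over register subspaces through pairings of the registers -/

section Averaging

open scoped Pointwise

/-- A random group element moves a fixed point to a uniformly random point of its orbit. -/
theorem expect_smul_eq {G X : Type*} [Group G] [Fintype G] [Fintype X] [MulAction G X]
    [MulAction.IsPretransitive G X] (f : X → ℝ) (x : X) : 𝔼 g : G, f (g • x) = 𝔼 y, f y := by
  have : Nonempty X := ⟨x⟩
  have h1 : ∀ y, 𝔼 g : G, f (g • y) = 𝔼 g : G, f (g • x) := fun y => by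
    obtain ⟨h, rfl⟩ := MulAction.exists_smul_eq G x y
    refine Fintype.expect_equiv (Equiv.mulRight h) _ _ fun g => ?_
    rw [Equiv.coe_mulRight, mul_smul]
  calc 𝔼 g : G, f (g • x) = 𝔼 y, 𝔼 g : G, f (g • y) := by
        simp only [h1]; rw [Fintype.expect_const]
    _ = 𝔼 g : G, 𝔼 y, f (g • y) := Finset.expect_comm _ _ _
    _ = 𝔼 _g : G, 𝔼 y, f y := Finset.expect_congr rfl fun g _ =>
        Fintype.expect_equiv (MulAction.toPerm g) _ _ fun y => rfl
    _ = 𝔼 y, f y := Fintype.expect_const _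

variable {n : ℕ}

/-- The register subspace spanned by the canonical basis vectors with indices in a set of `n / 2`
indices. -/
def regSubspaceOf (hn : 2 * (n / 2) = n) (S : Set.powersetCard (Fin n) (n / 2)) : RegSubspace n :=
  ⟨Submodule.span (ZMod 2) (stdVec '' ((S : Finset (Fin n)) : Set (Fin n))),
    ⟨S, rfl⟩, by rw [finrank_span_stdVec, Set.powersetCard.mem_iff.1 S.2, hn]⟩

theorem basisIndices_regSubspaceOf (hn : 2 * (n / 2) = n) (S : Set.powersetCard (Fin n) (n / 2)) :
    basisIndices (regSubspaceOf hn S).1 = S :=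
  basisIndices_span _

/-- Half-dimensional register subspaces correspond to sets of `n / 2` indices. -/
def regSubspaceEquiv (hn : 2 * (n / 2) = n) :
    Set.powersetCard (Fin n) (n / 2) ≃ RegSubspace n where
  toFun := regSubspaceOf hn
  invFun a := ⟨basisIndices a.1, a.card_basisIndices⟩
  left_inv S := Subtype.ext (basisIndices_regSubspaceOf hn S)
  right_inv a := by
    apply Subtype.ext
    ext v
    rw [RegSubspace.mem_iff, RegSubspace.mem_iff, basisIndices_regSubspaceOf]

instance : Fintype (Set.powersetCard (Fin n) (n / 2)) := Fintype.ofFinite _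

/-- A fixed pairing of the `n` registers. -/
def pairing (hn : 2 * (n / 2) = n) : Fin (n / 2) × ZMod 2 ≃ Fin n :=
  Fintype.equivOfCardEq (by simp only [Fintype.card_prod, Fintype.card_fin, ZMod.card]; omega)

/-- The set of indices that contains one element of every pair, selected by `y`. -/
def selection (hn : 2 * (n / 2) = n) (y : BitString (n / 2)) :
    Set.powersetCard (Fin n) (n / 2) :=
  ⟨Finset.univ.image fun i => pairing hn (i, y i), by
    rw [Set.powersetCard.mem_iff, Finset.card_image_of_injective, Finset.card_univ,
      Fintype.card_fin]
    intro i j h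
    exact (Prod.ext_iff.1 ((pairing hn).injective h)).1⟩

theorem card_selection_inter_le (hn : 2 * (n / 2) = n) (y z : BitString (n / 2)) :
    ((selection hn y : Finset (Fin n)) ∩ (selection hn z : Finset (Fin n))).card ≤
      (Finset.univ.filter fun i => y i = z i).card := by
  refine (Finset.card_le_card fun k hk => ?_).trans
    (Finset.card_image_le (f := fun i => pairing hn (i, y i)))
  simp only [selection, Finset.mem_inter, Finset.mem_image, Finset.mem_univ, true_and] at hk
  obtain ⟨⟨i, rfl⟩, j, hj⟩ := hk
  obtain ⟨rfl, h⟩ := Prod.ext_iff.1 ((pairing hn).injective hj)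
  exact Finset.mem_image.2 ⟨j, Finset.mem_filter.2 ⟨Finset.mem_univ _, h.symm⟩, rfl⟩

/-- The register subspaces that pick one register out of every pair, after the registers have been
permuted by `σ`. -/
def pairedSubspace (hn : 2 * (n / 2) = n) (σ : Equiv.Perm (Fin n)) (y : BitString (n / 2)) :
    RegSubspace n :=
  regSubspaceOf hn (σ • selection hn y)

theorem card_basisIndices_pairedSubspace_inter_le (hn : 2 * (n / 2) = n)
    (σ : Equiv.Perm (Fin n)) (y z : BitString (n / 2)) :
    (basisIndices (pairedSubspace hn σ y).1 ∩ basisIndices (pairedSubspace hn σ z).1).card ≤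
      (Finset.univ.filter fun i => y i = z i).card := by
  rw [pairedSubspace, pairedSubspace, basisIndices_regSubspaceOf, basisIndices_regSubspaceOf,
    Set.powersetCard.coe_smul, Set.powersetCard.coe_smul, ← Finset.smul_finset_inter,
    Finset.card_smul_finset]
  exact card_selection_inter_le hn y z

/-- A uniformly random half-dimensional register subspace can be sampled by first pairing the
registers at random and then picking one register of every pair at random. -/
theorem expect_regSubspace_eq (hn : 2 * (n / 2) = n) (f : RegSubspace n → ℝ) :
    𝔼 a, f a = 𝔼 σ : Equiv.Perm (Fin n), 𝔼 y, f (pairedSubspace hn σ y) := by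
  rw [Finset.expect_comm]
  have h : ∀ y, 𝔼 σ : Equiv.Perm (Fin n), f (pairedSubspace hn σ y) = 𝔼 a, f a := fun y => by
    have := Set.powersetCard.isPretransitive (n := n / 2) (α := Fin n)
    refine (expect_smul_eq (fun S => f (regSubspaceOf hn S)) (selection hn y)).trans ?_
    exact Fintype.expect_equiv (regSubspaceEquiv hn) _ _ fun S => rfl
  simp only [h]
  rw [Fintype.expect_const]

end Averaging

/-! ### Overlaps along a pairing -/

/-- The overlap of the subspaces of a pairing that are selected by `y` and `z`: a factor `1/√2` for
every pair in which they differ. -/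
def pairOverlap {k : ℕ} (y z : BitString k) : ℝ := ∏ i, if y i = z i then 1 else (√2)⁻¹

theorem pairOverlap_nonneg {k : ℕ} (y z : BitString k) : 0 ≤ pairOverlap y z :=
  Finset.prod_nonneg fun i _ => by split_ifs <;> positivity

theorem pairOverlap_comm {k : ℕ} (y z : BitString k) : pairOverlap y z = pairOverlap z y := by
  simp only [pairOverlap, eq_comm]

theorem pairOverlap_sq {k : ℕ} (y z : BitString k) :
    pairOverlap y z ^ 2 =
      ((2 : ℝ) ^ k)⁻¹ * 2 ^ (Finset.univ.filter fun i => y i = z i).card := by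
  have h : ∀ i, (if y i = z i then (1 : ℝ) else (√2)⁻¹) ^ 2 =
      2⁻¹ * if y i = z i then 2 else 1 := fun i => by
    split_ifs <;> simp
  rw [pairOverlap, ← Finset.prod_pow]
  simp only [h, Finset.prod_mul_distrib, Finset.prod_const, Finset.card_univ, Fintype.card_fin,
    Finset.prod_ite, one_pow, mul_one, inv_pow]

/-- The choices for the pairs are independent, and each pair contributes
`1 + 1/√2 = 2 cos² (π/8)`. -/
theorem sum_pairOverlap {k : ℕ} (y : BitString k) :
    ∑ z, pairOverlap y z = 2 ^ k * Real.cos (Real.pi / 8) ^ (2 * k) := by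
  have h1 : ∀ c : ZMod 2, ∑ b : ZMod 2, (if c = b then (1 : ℝ) else (√2)⁻¹) =
      2 * Real.cos (Real.pi / 8) ^ 2 := by
    intro c
    have h2 : 2 * Real.cos (Real.pi / 8) ^ 2 = 1 + (√2)⁻¹ := by
      have h3 : (√2)⁻¹ = √2 / 2 := by
        rw [eq_div_iff two_ne_zero, inv_mul_eq_iff_eq_mul₀ (by positivity),
          Real.mul_self_sqrt zero_le_two]
      rw [Real.cos_sq, show 2 * (Real.pi / 8) = Real.pi / 4 by ring, Real.cos_pi_div_four, h3]
      ring
    rw [h2, show (Finset.univ : Finset (ZMod 2)) = {0, 1} from rfl]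
    obtain rfl | rfl : c = 0 ∨ c = 1 := by revert c; decide
    · simp
    · simp [add_comm]
  calc ∑ z, pairOverlap y z = ∏ i, ∑ b : ZMod 2, (if y i = b then (1 : ℝ) else (√2)⁻¹) := by
        rw [Finset.prod_univ_sum, Fintype.piFinset_univ]; rfl
    _ = _ := by
        simp only [h1, Finset.prod_const, Finset.card_univ, Fintype.card_fin, mul_pow, ← pow_mul]

/-- The game value bound in the commuting-operator picture, for a vector `ψ` in place of the
purified state shared by Alice, Bob and Charlie. -/
theorem expect_reApplyInnerSelf_acceptOp_le {n : ℕ} (hn : 2 * (n / 2) = n) {H : Type*}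
    [NormedAddCommGroup H] [InnerProductSpace ℂ H] [CompleteSpace H]
    {B : RegSubspace n → BitString (n / 2) → H →L[ℂ] H}
    {C : RegSubspace n → BitString (n / 2) → BitString (n / 2) → H →L[ℂ] H}
    (hB : ∀ a t, (B a t).IsPositive) (hB1 : ∀ a, ∑ t, B a t = 1)
    (hC : ∀ a t s, (C a t s).IsPositive) (hC1 : ∀ a t, ∑ s, C a t s = 1)
    (hBC : ∀ a b r t s, Commute (B a r) (C b t s)) (U' : Finset (BitString (n / 2)))
    (ψ : PiLp 2 (fun _ : BitString n => H)) :
    𝔼 a : RegSubspace n, (acceptOp a.amp (B a) (C a) U').reApplyInnerSelf ψ ≤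
      √U'.card * Real.cos (Real.pi / 8) ^ n * ‖ψ‖ ^ 2 := by
  rw [expect_regSubspace_eq hn]
  refine Finset.expect_le Finset.univ_nonempty fun σ _ => ?_
  have key := sum_reApplyInnerSelf_le_of_overlap
    (fun y => acceptOp (pairedSubspace hn σ y).amp (B (pairedSubspace hn σ y))
      (C (pairedSubspace hn σ y)) U')
    (fun y => isPositive_acceptOp (hB _) (hC _) (fun t => hBC _ _ t t))
    (fun y z => √U'.card * pairOverlap y z)
    (fun y z => mul_nonneg (Real.sqrt_nonneg _) (pairOverlap_nonneg y z))
    (fun y z => by rw [pairOverlap_comm])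
    (r := √U'.card * (2 ^ (n / 2) * Real.cos (Real.pi / 8) ^ n))
    (by have : 0 ≤ Real.cos (Real.pi / 8) :=
          Real.cos_nonneg_of_mem_Icc ⟨by linarith [Real.pi_pos], by linarith [Real.pi_pos]⟩
        positivity)
    (fun y => by rw [← Finset.mul_sum, sum_pairOverlap, hn])
    (fun y z x => by
      refine (reApplyInnerSelf_acceptOp_acceptOp_le (ι := RegSubspace n) (lab := fun a => a.label)
        (fun a => a.sum_star_amp_mul_amp) (fun a => a.amp_eq_zero) (fun a => a.norm_amp_sq_le)
        hB hB1 hC hC1 hBC (pairedSubspace hn σ y) (pairedSubspace hn σ z)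
        (fun r t => (RegSubspace.card_label_eq_le _ _ r t).trans (Nat.pow_le_pow_right two_pos
          (card_basisIndices_pairedSubspace_inter_le hn σ y z))) x).trans_eq ?_
      rw [mul_pow, Real.sq_sqrt (Nat.cast_nonneg _), pairOverlap_sq]
      push_cast; rfl) ψ
  rw [Fintype.expect_eq_sum_div_card, div_le_iff₀ (by positivity)]
  refine key.trans_eq ?_
  simp only [Fintype.card_pi, ZMod.card, Finset.prod_const, Finset.card_univ, Fintype.card_fin]
  push_cast
  ring

/-! ### From channels to vectors -/

/-- Kraus decomposition of a channel, from a square root of its Choi matrix. -/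
theorem QuantumChannel.exists_kraus {X Y : Type} [Fintype X] [Fintype Y] [DecidableEq X]
    (Φ : QuantumChannel X Y) :
    ∃ K : X × Y → Matrix Y X ℂ, ∀ P, Φ.toMap P = ∑ k, K k * P * (K k)ᴴ := by
  classical
  let d : X × X → ℂ := fun p => if p.1 = p.2 then 1 else 0
  have hJ := Φ.completely_positive X (vecMulVec d (star d)) (posSemidef_vecMulVec_self_star d)
  obtain ⟨M, hM⟩ := CStarAlgebra.nonneg_iff_eq_star_mul_self.1 hJ.nonneg
  rw [star_eq_conjTranspose] at hM
  have hJe : ∀ v w y y', Φ.toMap (Matrix.single v w 1) y y' =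
      ∑ k, star (M k (v, y)) * M k (w, y') := by
    intro v w y y'
    have h1 := congrFun (congrFun hM (v, y)) (w, y')
    rw [mul_apply] at h1
    simp only [conjTranspose_apply] at h1
    rw [← h1]
    change _ = Φ.toMap _ y y'
    refine congrFun (congrFun (congrArg Φ.toMap ?_) y) y'
    ext x x'
    by_cases h2 : v = x <;> by_cases h3 : w = x' <;> simp [vecMulVec, d, Matrix.single, h2, h3]
  refine ⟨fun k => Matrix.of fun y v => star (M k (v, y)), fun P => ?_⟩
  ext y y'
  have hP : Φ.toMap P y y' = ∑ v, ∑ w, P v w * Φ.toMap (Matrix.single v w 1) y y' := by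
    conv_lhs => rw [matrix_eq_sum_single P]
    simp only [map_sum, Matrix.sum_apply]
    refine Finset.sum_congr rfl fun v _ => Finset.sum_congr rfl fun w _ => ?_
    rw [show Matrix.single v w (P v w) = P v w • Matrix.single v w (1 : ℂ) by
      rw [Matrix.smul_single, smul_eq_mul, mul_one], map_smul, Matrix.smul_apply, smul_eq_mul]
  simp only [hP, hJe, Matrix.sum_apply, mul_apply, of_apply, conjTranspose_apply, star_star,
    Finset.mul_sum, Finset.sum_mul]
  rw [Finset.sum_comm, Finset.sum_congr rfl fun w _ => Finset.sum_comm, Finset.sum_comm]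
  refine Finset.sum_congr rfl fun k _ => Finset.sum_congr rfl fun w _ =>
    Finset.sum_congr rfl fun v _ => by ring

/-- A Kraus operator as a vector in `ℂ^X ⊗ ℂ^Y`. -/
def krausVec {X Y : Type} [Fintype X] [Fintype Y] (K : Matrix Y X ℂ) :
    PiLp 2 (fun _ : X => EuclideanSpace ℂ Y) :=
  WithLp.toLp 2 fun v => WithLp.toLp 2 fun y => K y v

theorem contract_krausVec {X Y : Type} [Fintype X] [Fintype Y] (K : Matrix Y X ℂ) (b : X → ℂ) :
    contract b (krausVec K) = WithLp.toLp 2 (K *ᵥ b) := by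
  ext y
  simp [contract_apply, krausVec, mulVec, dotProduct, mul_comm]

theorem norm_krausVec_sq {X Y : Type} [Fintype X] [Fintype Y] (K : Matrix Y X ℂ) :
    ‖krausVec K‖ ^ 2 = (K * Kᴴ).trace.re := by
  rw [PiLp.norm_sq_eq_of_L2]
  simp only [EuclideanSpace.norm_sq_eq, krausVec, trace, diag, mul_apply, conjTranspose_apply,
    Complex.re_sum]
  rw [Finset.sum_comm]
  refine Finset.sum_congr rfl fun y _ => Finset.sum_congr rfl fun v _ => ?_
  rw [Complex.star_def, Complex.mul_conj, Complex.ofReal_re, Complex.normSq_eq_norm_sq]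

theorem trace_mul_kraus_re {X Y : Type} [Fintype X] [Fintype Y] [DecidableEq Y] (G : Matrix Y Y ℂ)
    (K : Matrix Y X ℂ) (b : X → ℂ) :
    (G * (K * vecMulVec b (star b) * Kᴴ)).trace.re =
      (toEuclideanCLM (𝕜 := ℂ) G).reApplyInnerSelf (contract b (krausVec K)) := by
  rw [contract_krausVec, reApplyInnerSelf, toEuclideanCLM_toLp, EuclideanSpace.inner_toLp_toLp,
    mul_vecMulVec, vecMulVec_mul, ← star_mulVec, mul_vecMulVec, trace_vecMulVec,
    RCLike.re_to_complex, ← Complex.conj_re]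
  simp [dotProduct, mul_comm]

theorem sum_kronecker {ι X Y : Type*} (s : Finset ι) (M : ι → Matrix X X ℂ) (N : Matrix Y Y ℂ) :
    (∑ i ∈ s, M i) ⊗ₖ N = ∑ i ∈ s, M i ⊗ₖ N := by
  ext
  simp [Matrix.sum_apply, Finset.sum_mul]

theorem kronecker_sum {ι X Y : Type*} (s : Finset ι) (M : Matrix X X ℂ) (N : ι → Matrix Y Y ℂ) :
    M ⊗ₖ (∑ i ∈ s, N i) = ∑ i ∈ s, M ⊗ₖ N i := by
  ext
  simp [Matrix.sum_apply, Finset.mul_sum]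

theorem isPositive_toEuclideanCLM {X : Type*} [Fintype X] [DecidableEq X] {M : Matrix X X ℂ}
    (hM : M.PosSemidef) : (toEuclideanCLM (𝕜 := ℂ) M).IsPositive := by
  rw [← isPositive_toLinearMap_iff, coe_toEuclideanCLM_eq_toEuclideanLin,
    Matrix.isPositive_toEuclideanLin_iff]
  exact hM

/-- The contribution to the winning probability of Bob's answer being `t + u`, for fixed `u`. -/
theorem Strategy.expect_trace_le {n : ℕ} (hn : 2 * (n / 2) = n) (S : Strategy n)
    (u : BitString (n / 2)) (U' : Finset (BitString (n / 2))) :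
    𝔼 a : RegSubspace n, 𝔼 t : BitString (n / 2), 𝔼 t' : BitString (n / 2), ∑ u' ∈ U',
      (((S.bob a).effect (t + u) ⊗ₖ (S.charlie a (t + u)).effect (t' + u')) *
        S.channel.toMap (a.cosetDensity t t')).trace.re ≤
      √U'.card * Real.cos (Real.pi / 8) ^ n := by
  obtain ⟨K, hK⟩ := S.channel.exists_kraus
  set B : RegSubspace n → BitString (n / 2) → _ := fun a t =>
    toEuclideanCLM (𝕜 := ℂ) ((S.bob a).effect (t + u) ⊗ₖ (1 : Matrix S.C S.C ℂ)) with hBdef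
  set C : RegSubspace n → BitString (n / 2) → BitString (n / 2) → _ := fun a t s =>
    toEuclideanCLM (𝕜 := ℂ) ((1 : Matrix S.B S.B ℂ) ⊗ₖ (S.charlie a (t + u)).effect s) with hCdef
  have hBp : ∀ a t, (B a t).IsPositive := fun a t =>
    isPositive_toEuclideanCLM (((S.bob a).posSemidef _).kronecker PosSemidef.one)
  have hCp : ∀ a t s, (C a t s).IsPositive := fun a t s =>
    isPositive_toEuclideanCLM (PosSemidef.one.kronecker ((S.charlie a (t + u)).posSemidef _))
  have hB1 : ∀ a, ∑ t, B a t = 1 := fun a => by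
    refine (Equiv.sum_comp (Equiv.addRight u) fun t => toEuclideanCLM (𝕜 := ℂ)
      ((S.bob a).effect t ⊗ₖ (1 : Matrix S.C S.C ℂ))).trans ?_
    rw [← map_sum, ← sum_kronecker, (S.bob a).sum_eq_one, one_kronecker_one, map_one]
  have hC1 : ∀ a t, ∑ s, C a t s = 1 := fun a t => by
    rw [hCdef, ← map_sum, ← kronecker_sum, (S.charlie a (t + u)).sum_eq_one, one_kronecker_one,
      map_one]
  have hmul : ∀ a b r t s, B a r * C b t s = toEuclideanCLM (𝕜 := ℂ)
      ((S.bob a).effect (r + u) ⊗ₖ (S.charlie b (t + u)).effect s) := fun a b r t s => by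
    rw [hBdef, hCdef, ← map_mul, ← mul_kronecker_mul, one_mul, mul_one]
  have hBC : ∀ a b r t s, Commute (B a r) (C b t s) := fun a b r t s => by
    rw [commute_iff_eq, hmul, hBdef, hCdef, ← map_mul, ← mul_kronecker_mul, one_mul, mul_one]
  have hN : ∑ k, ‖krausVec (K k)‖ ^ 2 = 2 ^ n := by
    have h := S.channel.trace_preserving 1
    rw [hK, trace_sum, trace_one] at h
    have h2 := congrArg Complex.re h
    simp only [Complex.re_sum, Matrix.mul_one] at h2
    simp only [norm_krausVec_sq]
    rw [h2, Complex.natCast_re]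
    simp
  have hval : ∀ a : RegSubspace n, 𝔼 t : BitString (n / 2), 𝔼 t' : BitString (n / 2), ∑ u' ∈ U',
      (((S.bob a).effect (t + u) ⊗ₖ (S.charlie a (t + u)).effect (t' + u')) *
        S.channel.toMap (a.cosetDensity t t')).trace.re =
      ∑ k, (acceptOp a.amp (B a) (C a) U').reApplyInnerSelf (krausVec (K k)) / 2 ^ n := by
    intro a
    have hterm : ∀ t t' u', (((S.bob a).effect (t + u) ⊗ₖ
        (S.charlie a (t + u)).effect (t' + u')) *
        S.channel.toMap (a.cosetDensity t t')).trace.re =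
        ∑ k, (B a t * C a t (t' + u')).reApplyInnerSelf (contract (a.amp t t') (krausVec (K k))) :=
      fun t t' u' => by
      rw [hK, Finset.mul_sum, trace_sum, Complex.re_sum]
      refine Finset.sum_congr rfl fun k _ => ?_
      rw [hmul, ← trace_mul_kraus_re]
      rfl
    have hcard : (Fintype.card (BitString (n / 2)) : ℝ) * Fintype.card (BitString (n / 2)) =
        2 ^ n := by
      simp only [Fintype.card_pi, ZMod.card, Finset.prod_const, Finset.card_univ, Fintype.card_fin]
      push_cast
      rw [← pow_add, ← two_mul, hn]
    simp only [hterm, Fintype.expect_eq_sum_div_card, ← Finset.sum_div, div_div, hcard,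
      reApplyInnerSelf_acceptOp]
    congr 1
    symm
    rw [Finset.sum_comm]
    refine Finset.sum_congr rfl fun t _ => ?_
    rw [Finset.sum_comm]
    refine Finset.sum_congr rfl fun t' _ => Finset.sum_comm
  simp only [hval]
  rw [Finset.expect_sum_comm]
  calc _ ≤ ∑ k, √U'.card * Real.cos (Real.pi / 8) ^ n * ‖krausVec (K k)‖ ^ 2 / 2 ^ n := by
        refine Finset.sum_le_sum fun k _ => ?_
        rw [← Finset.expect_div]
        gcongr
        exact expect_reApplyInnerSelf_acceptOp_le hn hBp hB1 hCp hC1 hBC U' _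
    _ = _ := by
        rw [← Finset.sum_div, ← Finset.mul_sum, hN, mul_div_assoc, div_self (by positivity),
          mul_one]

/-- The bound for arbitrary acceptance sets: the accepted errors `u ∈ U` of Bob are treated
separately, those of Charlie jointly, hence the different dependence on `U` and `U'`. -/
theorem Strategy.winProb_le {n : ℕ} (hn : 2 * (n / 2) = n) (S : Strategy n)
    (U U' : Finset (BitString (n / 2))) :
    S.winProb U U' ≤ U.card * (√U'.card * Real.cos (Real.pi / 8) ^ n) := by
  rw [Strategy.winProb]
  simp only [Finset.expect_sum_comm]
  rw [← nsmul_eq_mul]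
  exact Finset.sum_le_card_nsmul _ _ _ fun u _ => by
    simpa only [Finset.expect_sum_comm] using S.expect_trace_le hn u U'

/-! ### The size of Hamming balls -/

/-- The entropy bound on the size of a Hamming ball: under independent coin tosses with bias
`p = r / k ≤ 1/2`, every element of the ball has probability at least `2 ^ (-k h(p))`. -/
theorem card_hammingBall_le (k : ℕ) (r : ℝ) (hr0 : 0 ≤ r) (hr : r ≤ k / 2) :
    ((hammingBall k r).card : ℝ) ≤ 2 ^ (k * binaryEntropy (r / k)) := by
  rcases hr0.eq_or_lt with rfl | hr0
  · have h : hammingBall k 0 ⊆ {0} := fun x hx => by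
      simp only [hammingBall, Finset.mem_filter, Finset.mem_univ, true_and] at hx
      rw [Finset.mem_singleton, ← hammingNorm_eq_zero]
      exact_mod_cast le_antisymm hx (Nat.cast_nonneg _)
    have h1 := Finset.card_le_card h
    rw [Finset.card_singleton] at h1
    have h2 : (k : ℝ) * binaryEntropy (0 / k) = 0 := by simp [binaryEntropy]
    rw [h2, Real.rpow_zero]
    exact_mod_cast h1
  have hk : (0 : ℝ) < k := by linarith
  set p := r / k with hp
  have hrk : r = k * p := by rw [hp]; field_simp
  have hp0 : 0 < p := by positivity
  have hp1 : p ≤ 1 / 2 := by rw [hp, div_le_iff₀ hk]; linarith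
  have hq0 : 0 < 1 - p := by linarith
  set w : BitString k → ℝ := fun x => ∏ i, if x i = 0 then 1 - p else p with hw
  have hw0 : ∀ x, 0 ≤ w x := fun x => Finset.prod_nonneg fun i _ => by split_ifs <;> positivity
  have hw1 : ∑ x, w x = 1 := by
    have h1 : ∑ b : ZMod 2, (if b = 0 then 1 - p else p) = 1 := by
      rw [show (Finset.univ : Finset (ZMod 2)) = {0, 1} from rfl]
      simp
    calc ∑ x, w x = ∏ _i : Fin k, ∑ b : ZMod 2, (if b = 0 then 1 - p else p) := by
          rw [Finset.prod_univ_sum, Fintype.piFinset_univ]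
      _ = 1 := by simp [h1]
  have hL : Real.logb 2 p ≤ Real.logb 2 (1 - p) :=
    Real.logb_le_logb_of_le one_lt_two hp0 (by linarith)
  have hwx : ∀ x ∈ hammingBall k r, (2 : ℝ) ^ (-(k * binaryEntropy p)) ≤ w x := fun x hx => by
    simp only [hammingBall, Finset.mem_filter, Finset.mem_univ, true_and] at hx
    have hcard : (Finset.univ.filter fun i => x i = 0).card + hammingNorm x = k := by
      have := Finset.card_filter_add_card_filter_not (s := Finset.univ) fun i => x i = 0
      simpa [hammingNorm] using this
    have hw2 : w x = (1 - p) ^ (Finset.univ.filter fun i => x i = 0).card *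
        p ^ hammingNorm x := by
      simp only [hw, Finset.prod_ite, Finset.prod_const, hammingNorm]
    have hcast : ((Finset.univ.filter fun i => x i = 0).card : ℝ) = k - hammingNorm x := by
      rw [eq_sub_iff_add_eq]; exact_mod_cast hcard
    have hpow : ∀ y : ℝ, 0 < y → ∀ j : ℕ, y ^ j = (2 : ℝ) ^ (Real.logb 2 y * j) :=
      fun y hy j => by
        rw [Real.rpow_mul two_pos.le, Real.rpow_logb two_pos (by norm_num) hy, Real.rpow_natCast]
    rw [hw2, hpow _ hq0, hpow _ hp0, ← Real.rpow_add two_pos, hcast]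
    refine Real.rpow_le_rpow_of_exponent_le one_lt_two.le ?_
    rw [binaryEntropy]
    nlinarith [mul_nonneg (sub_nonneg.2 hL) (sub_nonneg.2 hx)]
  have hsum : ((hammingBall k r).card : ℝ) * (2 : ℝ) ^ (-(k * binaryEntropy p)) ≤ 1 := by
    rw [← nsmul_eq_mul]
    calc _ ≤ ∑ x ∈ hammingBall k r, w x := Finset.card_nsmul_le_sum _ _ _ hwx
      _ ≤ ∑ x, w x := Finset.sum_le_sum_of_subset_of_nonneg (Finset.subset_univ _)
          fun x _ _ => hw0 x
      _ = 1 := hw1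
  rw [Real.rpow_neg two_pos.le, ← div_eq_mul_inv, div_le_one (by positivity)] at hsum
  exact hsum

end RobustLeakyMoE

end

theorem mainTheorem4 (n : ℕ) (hn : Even n) (m m' : ℝ) (hm₀ : 0 ≤ m) (hm : m ≤ (n : ℝ) / 4)
    (hm'₀ : 0 ≤ m') (hm' : m' ≤ (n : ℝ) / 4) :
    BddAbove (Set.range fun S : RobustLeakyMoE.Strategy n =>
      S.winProb (RobustLeakyMoE.hammingBall (n / 2) m) (RobustLeakyMoE.hammingBall (n / 2) m')) ∧
    RobustLeakyMoE.optimalWinProb n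
        (RobustLeakyMoE.hammingBall (n / 2) m) (RobustLeakyMoE.hammingBall (n / 2) m') ≤
      √(Real.exp 1) *
        (2 : ℝ) ^ ((n : ℝ) / 2 * RobustLeakyMoE.binaryEntropy (2 * m / n) +
          (n : ℝ) / 4 * RobustLeakyMoE.binaryEntropy (2 * m' / n)) *
        Real.cos (Real.pi / 8) ^ n := by
  have hn2 : 2 * (n / 2) = n := Nat.two_mul_div_two_of_even hn
  have hk : ((n / 2 : ℕ) : ℝ) = (n : ℝ) / 2 := by
    rw [eq_div_iff two_ne_zero, mul_comm]; exact_mod_cast hn2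
  have hcos : 0 ≤ Real.cos (Real.pi / 8) :=
    Real.cos_nonneg_of_mem_Icc ⟨by linarith [Real.pi_pos], by linarith [Real.pi_pos]⟩
  have hdiv : ∀ x : ℝ, x / ((n : ℝ) / 2) = 2 * x / n := fun x => by
    rw [div_div_eq_mul_div, mul_comm]
  have hU := RobustLeakyMoE.card_hammingBall_le (n / 2) m hm₀ (by rw [hk]; linarith)
  have hU' := RobustLeakyMoE.card_hammingBall_le (n / 2) m' hm'₀ (by rw [hk]; linarith)
  rw [hk, hdiv] at hU hU'
  have hsqrt : √((RobustLeakyMoE.hammingBall (n / 2) m').card : ℝ) ≤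
      (2 : ℝ) ^ ((n : ℝ) / 4 * RobustLeakyMoE.binaryEntropy (2 * m' / n)) := by
    refine (Real.sqrt_le_sqrt hU').trans_eq ?_
    rw [Real.sqrt_eq_rpow, ← Real.rpow_mul two_pos.le]
    congr 1
    ring
  have hexp : 1 ≤ √(Real.exp 1) := Real.one_le_sqrt.2 (Real.one_le_exp zero_le_one)
  have hbound : ∀ S : RobustLeakyMoE.Strategy n,
      S.winProb (RobustLeakyMoE.hammingBall (n / 2) m) (RobustLeakyMoE.hammingBall (n / 2) m') ≤
      √(Real.exp 1) *
        (2 : ℝ) ^ ((n : ℝ) / 2 * RobustLeakyMoE.binaryEntropy (2 * m / n) +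
          (n : ℝ) / 4 * RobustLeakyMoE.binaryEntropy (2 * m' / n)) *
        Real.cos (Real.pi / 8) ^ n := fun S => by
    refine (S.winProb_le hn2 _ _).trans ?_
    rw [Real.rpow_add two_pos, ← mul_assoc]
    refine mul_le_mul_of_nonneg_right ?_ (pow_nonneg hcos n)
    calc _ ≤ (2 : ℝ) ^ ((n : ℝ) / 2 * RobustLeakyMoE.binaryEntropy (2 * m / n)) *
          (2 : ℝ) ^ ((n : ℝ) / 4 * RobustLeakyMoE.binaryEntropy (2 * m' / n)) := by gcongr
      _ ≤ _ := le_mul_of_one_le_left (by positivity) hexp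
  exact ⟨⟨_, Set.forall_mem_range.2 hbound⟩, Real.iSup_le hbound (by positivity)⟩
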